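/- Let $(X,d)$ be a proper, non-compact $\mathrm{CAT}(-1)$ space and $o\in X$. Let $\partial_\infty X$ be its ideal boundary (classes of rays at bounded distance from each other). For $\xi\in\partial_\infty X$ and $p\in X$ let $\beta^p_\xi(z)=\lim_{t\to\infty}\bigl(d(z,c(t))-t\bigr)$, where $c$ is the ray with $c(0)=p$ and $c(\infty)=\xi$. A sequence $x_n\in X$ converges to $\xi$ if it does so in the horofunction compactification of $X$, i.e. if $d(x_n,\cdot)-d(x_n,o)\to\beta^o_\xi$ uniformly on compact sets. Let $G$ be the set of parametrized geodesics (isometric embeddings $g:\mathbb R\to X$) with the topology of uniform convergence on compact sets, and let $g(\pm\infty)$ be the ideal endpoints of $g\in G$. Say that a sequence $(x_n,y_n)$ in $X\times X$ satisfies $(\ast)$ for $g\in G$ if $$x_n\to g(+\infty),\qquad y_n\to g(-\infty),\qquad d(x_n,o)-d(y_n,o)\to\beta^o_{g(-\infty)}(g(0))-\beta^o_{g(+\infty)}(g(0)).$$ Give the disjoint union $X\times X\cup G$ the topology in which $U$ is open if and only if $U\cap(X\times X)$ is open in $X\times X$, $U\cap G$ is open in $G$, and every sequence in $X\times X$ that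 satisfies $(\ast)$ for some $g\in U\cap G$ is eventually in $U$. Then: 1. $X\times X$ is an open subspace and $G$ a closed subspace of $X\times X\cup G$, each with its original topology, and a sequence $(x_n,y_n)$ in $X\times X$ converges to $g\in G$ in $X\times X\cup G$ if and only if it satisfies $(\ast)$ for $g$. 2. Each point of $X\times X$ has a unique nearest point in the diagonal $\Delta=\{(x,x): x\in X\}$ with respect to $d_{\max}((x,y),(x',y'))=\max\{d(x,x'),d(y,y')\}$. Let $\rho:X\times X\to\Delta$ be the nearest-point map. Then its extension $$\tilde\rho: X\times X\cup G\to\Delta,\qquad \tilde\rho|_{X\times X}=\rho,\qquad \tilde\rho(g)=(g(0),g(0))\ \text{ for } g\in G,$$ is continuous. -/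

import Mathlib

open Filter Topology
open scoped NNReal UpperHalfPlane

namespace MaxCompactification

/-- `c` is a geodesic segment from `p` to `q`: it is an isometric embedding of
`[0, dist p q]` (its values elsewhere are irrelevant) with `c 0 = p` and `c (dist p q) = q`. -/
structure IsSegment {X : Type*} [MetricSpace X] (c : ℝ → X) (p q : X) : Prop where
  source : c 0 = p
  target : c (dist p q) = q
  isometric : ∀ s ∈ Set.Icc 0 (dist p q), ∀ t ∈ Set.Icc 0 (dist p q),
    dist (c s) (c t) = |s - t|

/-- `x'` is the point of the segment `p' q'` of the hyperbolic plane at distance `s`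
from `p'`. -/
def IsPointOnSegmentAt (p' q' x' : ℍ) (s : ℝ) : Prop :=
  dist p' x' = s ∧ dist x' q' = dist p' q' - s

/-- `CAT(-1)` spaces: geodesic metric spaces in which every geodesic triangle is at least as
thin as its comparison triangle in the hyperbolic plane (the upper half-plane with its metric of
curvature `-1`). The vertices `p, q, r` are arbitrary, so that `c s` and `c' t` range over the
pairs of points on two different sides of any triangle; for two points on the same side the
comparison is trivial. A comparison triangle always exists and is unique up to isometry. -/
structure IsCATNegOne (X : Type*) [MetricSpace X] : Prop where
  exists_segment : ∀ p q : X, ∃ c : ℝ → X, IsSegment c p q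
  comparison : ∀ (p q r : X) (c c' : ℝ → X), IsSegment c p q → IsSegment c' p r →
    ∃ p' q' r' : ℍ, dist p' q' = dist p q ∧ dist p' r' = dist p r ∧ dist q' r' = dist q r ∧
      ∀ s ∈ Set.Icc 0 (dist p q), ∀ t ∈ Set.Icc 0 (dist p r), ∀ x' y' : ℍ,
        IsPointOnSegmentAt p' q' x' s → IsPointOnSegmentAt p' r' y' t →
          dist (c s) (c' t) ≤ dist x' y'

/-- Rays: isometric embeddings `[0, ∞) → X`. -/
abbrev Ray (X : Type*) [MetricSpace X] : Type _ := {c : ℝ≥0 → X // Isometry c}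

/-- Two rays are asymptotic if they stay at bounded distance from each other. -/
instance raySetoid (X : Type*) [MetricSpace X] : Setoid (Ray X) where
  r c c' := ∃ C : ℝ, ∀ t : ℝ≥0, dist (c.1 t) (c'.1 t) ≤ C
  iseqv :=
    { refl := fun c => ⟨0, fun t => (dist_self (c.1 t)).le⟩
      symm := fun ⟨C, hC⟩ => ⟨C, fun t => (dist_comm _ _).trans_le (hC t)⟩
      trans := fun ⟨C, hC⟩ ⟨C', hC'⟩ =>
        ⟨C + C', fun t => (dist_triangle _ _ _).trans (add_le_add (hC t) (hC' t))⟩ }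

/-- The ideal boundary `∂∞ X`: classes of asymptotic rays. -/
def IdealBoundary (X : Type*) [MetricSpace X] : Type _ := Quotient (raySetoid X)

/-- The point `c(∞)` of the ideal boundary. -/
def Ray.endpoint {X : Type*} [MetricSpace X] (c : Ray X) : IdealBoundary X :=
  Quotient.mk (raySetoid X) c

open Classical in
/-- The Busemann function `β^p_ξ (z) = lim_{t → ∞} dist z (c t) - t`, where `c` is the ray with
`c(0) = p` and `c(∞) = ξ`. In a proper `CAT(-1)` space this ray exists and is unique; the limit
always exists, since `t ↦ dist z (c t) - t` is non-increasing and bounded below. -/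
noncomputable def busemann {X : Type*} [MetricSpace X] (ξ : IdealBoundary X) (p z : X) : ℝ :=
  if h : ∃ c : Ray X, c.1 0 = p ∧ Ray.endpoint c = ξ then
    limUnder atTop (fun t : ℝ≥0 => dist z (h.choose.1 t) - (t : ℝ))
  else 0

/-- Convergence of a sequence `x n` in `X` to the point `ξ` at infinity, in the horofunction
compactification of `X`: the distance functions from `x n`, normalized to vanish at the base
point `o`, converge to `β^o_ξ` uniformly on compact sets. -/
def TendstoBoundary {X : Type*} [MetricSpace X] (o : X) (x : ℕ → X) (ξ : IdealBoundary X) :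
    Prop :=
  ∀ K : Set X, IsCompact K →
    TendstoUniformlyOn (fun n z => dist (x n) z - dist (x n) o) (busemann ξ o) atTop K

/-- The set `G` of parametrized geodesics, i.e. isometric embeddings `ℝ → X`, as a subspace of
`C(ℝ, X)` with the topology of uniform convergence on compact sets. -/
abbrev Geodesic (X : Type*) [MetricSpace X] : Type _ := {g : C(ℝ, X) // Isometry g}

/-- The ray `t ↦ g t`. -/
def Geodesic.posRay {X : Type*} [MetricSpace X] (g : Geodesic X) : Ray X :=
  ⟨fun t => g.1 (t : ℝ), g.2.comp (Isometry.of_dist_eq fun _ _ => rfl)⟩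

/-- The ray `t ↦ g (-t)`. -/
def Geodesic.negRay {X : Type*} [MetricSpace X] (g : Geodesic X) : Ray X :=
  ⟨fun t => g.1 (-(t : ℝ)), g.2.comp (Isometry.of_dist_eq fun s t => dist_neg_neg (s : ℝ) t)⟩

/-- The ideal endpoint `g(+∞)`. -/
def Geodesic.posEnd {X : Type*} [MetricSpace X] (g : Geodesic X) : IdealBoundary X :=
  Ray.endpoint g.posRay

/-- The ideal endpoint `g(-∞)`. -/
def Geodesic.negEnd {X : Type*} [MetricSpace X] (g : Geodesic X) : IdealBoundary X :=
  Ray.endpoint g.negRay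

/-- The prescribed convergence of a sequence `u n = (x n, y n)` in `X × X` to a geodesic `g`. -/
def TendstoGeodesic {X : Type*} [MetricSpace X] (o : X) (u : ℕ → X × X) (g : Geodesic X) :
    Prop :=
  TendstoBoundary o (fun n => (u n).1) g.posEnd ∧
  TendstoBoundary o (fun n => (u n).2) g.negEnd ∧
  Tendsto (fun n => dist (u n).1 o - dist (u n).2 o) atTop
    (𝓝 (busemann g.negEnd o (g.1 0) - busemann g.posEnd o (g.1 0)))

/-- The set `X × X ∪ G` (a disjoint union). -/
inductive Extended (X : Type*) [MetricSpace X] : Type _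
  | pt (p : X × X) : Extended X
  | geod (g : Geodesic X) : Extended X

/-- The topology of `X × X ∪ G`: `U` is open if its traces on `X × X` and on `G` are open and if
every sequence of `X × X` which converges to a geodesic of `U` in the prescribed sense is
eventually in `U`. -/
@[reducible] def extendedTopology {X : Type*} [MetricSpace X] (o : X) : TopologicalSpace (Extended X) where
  IsOpen U := IsOpen (Extended.pt ⁻¹' U) ∧ IsOpen (Extended.geod ⁻¹' U) ∧
    ∀ (u : ℕ → X × X) (g : Geodesic X), Extended.geod g ∈ U → TendstoGeodesic o u g →
      ∀ᶠ n in atTop, Extended.pt (u n) ∈ U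
  isOpen_univ := ⟨isOpen_univ, isOpen_univ, fun _ _ _ _ => Eventually.of_forall fun _ => trivial⟩
  isOpen_inter := fun _ _ hU hV => ⟨hU.1.inter hV.1, hU.2.1.inter hV.2.1, fun u g hg hu =>
    (hU.2.2 u g hg.1 hu).and (hV.2.2 u g hg.2 hu)⟩
  isOpen_sUnion := by
    intro S hS
    refine ⟨?_, ?_, ?_⟩
    · rw [Set.preimage_sUnion]
      exact isOpen_biUnion fun U hU => (hS U hU).1
    · rw [Set.preimage_sUnion]
      exact isOpen_biUnion fun U hU => (hS U hU).2.1
    · rintro u g ⟨U, hU, hg⟩ hu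
      exact ((hS U hU).2.2 u g hg hu).mono fun n hn => ⟨U, hU, hn⟩

/-- `q` is a point of the diagonal `Δ` of `X × X` nearest to `p`. The distance that Mathlib puts
on `X × X` is the maximum distance. -/
def IsNearestPoint {X : Type*} [MetricSpace X] (p : X × X) (q : Set.diagonal X) : Prop :=
  ∀ q' : Set.diagonal X, dist p q.1 ≤ dist p q'.1

/-- The extension of a map `ρ : X × X → Δ` to `X × X ∪ G` by `g ↦ (g 0, g 0)`. -/
def extendRetraction {X : Type*} [MetricSpace X] (ρ : X × X → Set.diagonal X) :
    Extended X → Set.diagonal X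
  | Extended.pt p => ρ p
  | Extended.geod g => ⟨(g.1 0, g.1 0), rfl⟩

end MaxCompactification

/-! Everything rests on one inequality. On a hyperbolic segment of length `L`, the function `cosh
(dist z ·)` satisfies Stewart's identity, and comparison turns it into an upper bound in a `CAT(-1)`
space.

At the middle of a segment it says that a point almost within `L / 2` of both ends is close to the
midpoint, uniformly in `L`. Nearest points of the diagonal are the midpoints, so this gives their
uniqueness and the continuity of `ρ`. Letting one end go to infinity gives `cosh (dist z (r s)) ≤
exp (-s) * cosh (dist z (r 0)) + sinh s * exp β`, where `β` is the Busemann function of the ray.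
This makes Busemann functions independent of the base point up to a constant, and continuous in the
geodesic. The functions in `(∗)` therefore extend continuously to `X × X ∪ G`, so topological
convergence to a geodesic implies `(∗)`; the converse is built into the topology.

If `(x, y)` satisfies `(∗)` for `g`, a further use of Stewart shows `dist x (g 0) + dist y (g 0) -
dist x y → 0`, while the third condition gives `dist x (g 0) - dist y (g 0) → 0`. So `g 0` is almost
a midpoint, and the true midpoints converge to it. -/

namespace MaxCompactification

/-! ### Stewart's theorem -/

open Real

/-- Points of a segment of the hyperbolic plane, with Stewart's identity: in the hyperboloid model
the point at distance `s` from `p` is a linear combination of `p` and `q`. -/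
theorem exists_isPointOnSegmentAt (p q : ℍ) {s : ℝ} (hpq : 0 < dist p q)
    (hs : s ∈ Set.Icc 0 (dist p q)) :
    ∃ x : ℍ, IsPointOnSegmentAt p q x s ∧ ∀ z : ℍ, sinh (dist p q) * cosh (dist z x) =
      sinh (dist p q - s) * cosh (dist z p) + sinh s * cosh (dist z q) := by
  obtain ⟨a, ha⟩ : ∃ a, a = dist p q - s := ⟨_, rfl⟩
  have hL : dist p q = a + s := by linarith
  have ha0 : 0 ≤ a := by linarith [hs.2]
  have hs0 : 0 ≤ s := hs.1
  have hc := UpperHalfPlane.cosh_dist' p q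
  rw [hL] at hpq hc ⊢
  have hS : 0 < sinh (a + s) := sinh_pos_iff.2 hpq
  have hp := p.im_pos
  have hq := q.im_pos
  -- On the hyperboloid, `α p + β q` is the point of the segment at distance `s` from `p` and `a`
  -- from `q`; `h1`, `h2` and `hnorm` are its pairings with `p`, `q` and itself.
  obtain ⟨α, hα⟩ : ∃ α, α = sinh a / sinh (a + s) := ⟨_, rfl⟩
  obtain ⟨β, hβ⟩ : ∃ β, β = sinh s / sinh (a + s) := ⟨_, rfl⟩
  have hα0 : 0 ≤ α := hα ▸ div_nonneg (sinh_nonneg_iff.2 ha0) hS.le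
  have hβ0 : 0 ≤ β := hβ ▸ div_nonneg (sinh_nonneg_iff.2 hs0) hS.le
  have hαβ : 0 < α + β := by
    rw [hα, hβ, ← add_div]
    refine div_pos ?_ hS
    rcases ha0.eq_or_lt with h | h
    · rw [← h, sinh_zero, zero_add]
      exact sinh_pos_iff.2 (by linarith)
    · exact add_pos_of_pos_of_nonneg (sinh_pos_iff.2 h) (sinh_nonneg_iff.2 hs0)
  have hα' : α * sinh (a + s) = sinh a := by rw [hα]; field_simp
  have hβ' : β * sinh (a + s) = sinh s := by rw [hβ]; field_simp
  have e1 := cosh_sq a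
  have e2 := cosh_sq s
  have h1 : α + β * cosh (a + s) = cosh s := by
    refine mul_right_cancel₀ hS.ne' ?_
    have : (α + β * cosh (a + s)) * sinh (a + s) = sinh a + sinh s * cosh (a + s) := by
      rw [← hα', ← hβ']; ring
    rw [this, sinh_add, cosh_add]
    linear_combination (-sinh a) * e2
  have h2 : α * cosh (a + s) + β = cosh a := by
    refine mul_right_cancel₀ hS.ne' ?_
    have : (α * cosh (a + s) + β) * sinh (a + s) = sinh a * cosh (a + s) + sinh s := by
      rw [← hα', ← hβ']; ring
    rw [this, sinh_add, cosh_add]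
    linear_combination (-sinh s) * e1
  have hnorm : α ^ 2 + β ^ 2 + 2 * α * β * cosh (a + s) = 1 := by
    have : α ^ 2 + β ^ 2 + 2 * α * β * cosh (a + s) = α * cosh s + β * cosh a := by
      rw [← h1, ← h2]; ring
    rw [this]
    refine mul_right_cancel₀ hS.ne' ?_
    have : (α * cosh s + β * cosh a) * sinh (a + s) = sinh a * cosh s + sinh s * cosh a := by
      rw [← hα', ← hβ']; ring
    rw [this, sinh_add]; ring
  -- The map `z ↦ (1 / im, re / im, |z|² / im)` identifies `ℍ` with a sheet of `u w - v² = 1`, on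
  -- which `cosh dist` is bilinear. The combination is therefore the point with `re = v / u` and `im
  -- = 1 / u`.
  obtain ⟨u, hu⟩ : ∃ u, u = α / p.im + β / q.im := ⟨_, rfl⟩
  obtain ⟨v, hv⟩ : ∃ v, v = α * p.re / p.im + β * q.re / q.im := ⟨_, rfl⟩
  obtain ⟨w, hw⟩ : ∃ w, w = α * (p.re ^ 2 + p.im ^ 2) / p.im + β * (q.re ^ 2 + q.im ^ 2) / q.im :=
    ⟨_, rfl⟩
  have hu0 : 0 < u := by
    rw [hu]
    rcases hα0.eq_or_lt with h | h
    · rw [← h, zero_div, zero_add]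
      exact div_pos (by linarith) hq
    · exact add_pos_of_pos_of_nonneg (div_pos h hp) (div_nonneg hβ0 hq.le)
  have huvw : u * w - v ^ 2 = 1 := by
    rw [← hnorm, hc, hu, hv, hw]
    field_simp
    ring
  let x : ℍ := ⟨⟨v / u, 1 / u⟩, by simpa using hu0⟩
  have hxre : x.re = v / u := rfl
  have hxim : x.im = 1 / u := rfl
  have hx : ∀ z : ℍ, cosh (dist z x) = α * cosh (dist z p) + β * cosh (dist z q) := by
    intro z
    have hz := z.im_pos
    have h3 : cosh (dist z x) = (u * (z.re ^ 2 + z.im ^ 2) - 2 * z.re * v + w) / (2 * z.im) := by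
      rw [UpperHalfPlane.cosh_dist', hxre, hxim]
      field_simp
      linear_combination (-1) * huvw
    rw [h3, UpperHalfPlane.cosh_dist', UpperHalfPlane.cosh_dist', hu, hv, hw]
    field_simp
    ring
  refine ⟨x, ⟨?_, ?_⟩, fun z => ?_⟩
  · refine cosh_injOn (by exact dist_nonneg) hs0 ?_
    rw [hx, dist_self, cosh_zero, hL, mul_one, h1]
  · rw [hL, add_sub_cancel_right]
    refine cosh_injOn (by exact dist_nonneg) ha0 ?_
    rw [dist_comm, hx, dist_self, cosh_zero, dist_comm q p, hL, mul_one, h2]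
  · rw [hx, add_sub_cancel_right, ← hα', ← hβ']
    ring

variable {X : Type*} [MetricSpace X]

/-- Stewart's inequality in a `CAT(-1)` space. -/
theorem IsCATNegOne.stewart (hX : IsCATNegOne X) {p q : X} {c : ℝ → X} (hc : IsSegment c p q)
    (z : X) {s : ℝ} (hs : s ∈ Set.Icc 0 (dist p q)) :
    sinh (dist p q) * cosh (dist z (c s)) ≤
      sinh (dist p q - s) * cosh (dist z p) + sinh s * cosh (dist z q) := by
  rcases (dist_nonneg (x := p) (y := q)).eq_or_lt with h | h
  · have hs0 : s = 0 := le_antisymm (h ▸ hs.2) hs.1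
    simp [← h, hs0]
  obtain ⟨c', hc'⟩ := hX.exists_segment p z
  obtain ⟨p', q', r', hpq, hpr, hqr, H⟩ := hX.comparison p q z c c' hc hc'
  obtain ⟨x, hx, hst⟩ := exists_isPointOnSegmentAt p' q' (hpq ▸ h) (hpq.symm ▸ hs)
  -- Only the comparison between a point of one side and the opposite vertex is needed.
  have h1 := H s hs (dist p z) ⟨dist_nonneg, le_rfl⟩ x r' hx ⟨hpr, by rw [dist_self, hpr, sub_self]⟩
  have h2 := hst r'
  rw [hc'.target, dist_comm] at h1
  rw [hpq, dist_comm r' p', hpr, dist_comm r' q', hqr] at h2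
  rw [dist_comm z p, dist_comm z q, ← h2]
  refine mul_le_mul_of_nonneg_left ?_ (sinh_nonneg_iff.2 h.le)
  rw [cosh_le_cosh, abs_of_nonneg dist_nonneg, abs_of_nonneg dist_nonneg, dist_comm r' x]
  exact h1

/-! ### Asymptotics of Stewart's bound -/

section Hyperbolic

variable {ι : Type*} {l : Filter ι}

theorem tendsto_zero_of_cosh_le {d ε : ι → ℝ} (hd : ∀ᶠ i in l, cosh (d i) ≤ ε i)
    (hε : Tendsto ε l (𝓝 1)) : Tendsto d l (𝓝 0) := by
  have h1 : Tendsto (fun i => cosh (d i)) l (𝓝 1) :=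
    tendsto_of_tendsto_of_tendsto_of_le_of_le' tendsto_const_nhds hε
      (Eventually.of_forall fun i => one_le_cosh _) hd
  have h2 : Tendsto (fun i => sinh (d i) ^ 2) l (𝓝 0) := by
    have := (h1.pow 2).sub_const 1
    simp only [one_pow, sub_self] at this
    refine this.congr fun i => ?_
    rw [sinh_sq]
  have h3 : Tendsto (fun i => |sinh (d i)|) l (𝓝 0) := by
    have := h2.sqrt
    simpa only [sqrt_sq_eq_abs, sqrt_zero] using this
  have h4 := (continuous_arsinh.tendsto 0).comp
    ((tendsto_zero_iff_abs_tendsto_zero (fun i => sinh (d i))).2 h3)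
  simpa [Function.comp_def] using h4

/-- Of the two exponentials in `cosh E`, the growing one contributes `exp (E - L) / 2`; the other
carries a factor `exp (-2 * L)` and dies. -/
theorem tendsto_cosh_mul_exp_neg {E L : ι → ℝ} {β : ℝ} (hL : Tendsto L l atTop)
    (hE : Tendsto (fun i => E i - L i) l (𝓝 β)) :
    Tendsto (fun i => cosh (E i) * exp (-L i)) l (𝓝 (exp β / 2)) := by
  have h1 : Tendsto (fun i => exp (-(E i - L i)) * (exp (-L i) * exp (-L i))) l
      (𝓝 (exp (-β) * (0 * 0))) := by
    have h := tendsto_exp_neg_atTop_nhds_zero.comp hL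
    exact ((continuous_exp.tendsto _).comp hE.neg).mul (h.mul h)
  have h2 := (((continuous_exp.tendsto _).comp hE).add h1).div_const 2
  rw [mul_zero, mul_zero, add_zero] at h2
  refine h2.congr fun i => ?_
  simp only [Function.comp_apply]
  rw [cosh_eq, ← exp_add, ← exp_add, div_mul_eq_mul_div, add_mul, ← exp_add, ← exp_add]
  ring_nf

theorem tendsto_sinh_mul_exp_neg {E L : ι → ℝ} {β : ℝ} (hL : Tendsto L l atTop)
    (hE : Tendsto (fun i => E i - L i) l (𝓝 β)) :
    Tendsto (fun i => sinh (E i) * exp (-L i)) l (𝓝 (exp β / 2)) := by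
  have h1 : Tendsto (fun i => exp (-(E i - L i)) * (exp (-L i) * exp (-L i))) l
      (𝓝 (exp (-β) * (0 * 0))) := by
    have h := tendsto_exp_neg_atTop_nhds_zero.comp hL
    exact ((continuous_exp.tendsto _).comp hE.neg).mul (h.mul h)
  have h2 := (((continuous_exp.tendsto _).comp hE).sub h1).div_const 2
  rw [mul_zero, mul_zero, sub_zero] at h2
  refine h2.congr fun i => ?_
  simp only [Function.comp_apply]
  rw [sinh_eq, ← exp_add, ← exp_add, div_mul_eq_mul_div, sub_mul, ← exp_add, ← exp_add]
  ring_nf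

/-- The limit of the bound in Stewart's inequality as one end of the segment goes to infinity. -/
theorem tendsto_stewart_bound {E L : ι → ℝ} {β : ℝ} (hL : Tendsto L l atTop)
    (hE : Tendsto (fun i => E i - L i) l (𝓝 β)) (s a : ℝ) :
    Tendsto (fun i => (sinh (L i - s) * a + sinh s * cosh (E i)) / sinh (L i)) l
      (𝓝 (exp (-s) * a + sinh s * exp β)) := by
  have h1 : Tendsto (fun i => sinh (L i - s) * exp (-L i)) l (𝓝 (exp (-s) / 2)) :=
    tendsto_sinh_mul_exp_neg hL (tendsto_const_nhds.congr fun i => by ring)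
  have h2 : Tendsto (fun i => sinh (L i) * exp (-L i)) l (𝓝 (exp 0 / 2)) :=
    tendsto_sinh_mul_exp_neg hL (tendsto_const_nhds.congr fun i => by ring)
  have h3 := tendsto_cosh_mul_exp_neg hL hE
  have h4 := ((h1.mul_const a).add (h3.const_mul (sinh s))).div h2 (by simp)
  have e : (exp (-s) / 2 * a + sinh s * (exp β / 2)) / (exp 0 / 2) =
      exp (-s) * a + sinh s * exp β := by
    rw [exp_zero]; ring
  rw [e] at h4
  refine h4.congr fun i => ?_
  have h5 := (exp_pos (-L i)).ne'
  simp only [Pi.div_apply]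
  rw [← mul_div_mul_right _ (sinh (L i)) h5]
  ring

end Hyperbolic

theorem IsCATNegOne.cosh_dist_le_div (hX : IsCATNegOne X) {p q : X} {c : ℝ → X}
    (hc : IsSegment c p q) (z : X) {s : ℝ} (hs : s ∈ Set.Icc 0 (dist p q)) (hpq : 0 < dist p q) :
    cosh (dist z (c s)) ≤
      (sinh (dist p q - s) * cosh (dist z p) + sinh s * cosh (dist z q)) / sinh (dist p q) := by
  rw [le_div_iff₀ (sinh_pos_iff.2 hpq), mul_comm]
  exact hX.stewart hc z hs

/-- Stewart's inequality for a limit of segments whose second ends go to infinity. -/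
theorem IsCATNegOne.cosh_dist_le_of_tendsto (hX : IsCATNegOne X) {ι : Type*} {l : Filter ι}
    [NeBot l] {p z x : X} {q : ι → X} {c : ι → ℝ → X} (hc : ∀ i, IsSegment (c i) p (q i))
    (hL : Tendsto (fun i => dist p (q i)) l atTop) {β : ℝ}
    (hβ : Tendsto (fun i => dist z (q i) - dist p (q i)) l (𝓝 β)) {s : ℝ} (hs : 0 ≤ s)
    (hx : Tendsto (fun i => c i s) l (𝓝 x)) :
    cosh (dist z x) ≤ exp (-s) * cosh (dist z p) + sinh s * exp β := by
  refine le_of_tendsto_of_tendsto ((continuous_cosh.tendsto _).comp (tendsto_const_nhds.dist hx))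
    (tendsto_stewart_bound hL hβ s (cosh (dist z p))) ?_
  filter_upwards [hL.eventually_gt_atTop s] with i hi
  exact hX.cosh_dist_le_div (hc i) z ⟨hs, hi.le⟩ (hs.trans_lt hi)

/-! ### Midpoints and nearest points of the diagonal -/

/-- Stewart's inequality at half the length, divided by `sinh (dist p q / 2)`. -/
theorem IsCATNegOne.cosh_dist_midpoint_le (hX : IsCATNegOne X) {p q : X} {c : ℝ → X}
    (hc : IsSegment c p q) (z : X) :
    2 * cosh (dist p q / 2) * cosh (dist z (c (dist p q / 2))) ≤
      cosh (dist z p) + cosh (dist z q) := by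
  rcases (dist_nonneg (x := p) (y := q)).eq_or_lt with h | h
  · have hpq : p = q := dist_eq_zero.1 h.symm
    rw [← h, zero_div, hc.source, ← hpq, cosh_zero]
    linarith
  · have h1 := hX.stewart hc z (s := dist p q / 2) ⟨by linarith, by linarith⟩
    have h2 : sinh (dist p q) = 2 * sinh (dist p q / 2) * cosh (dist p q / 2) := by
      rw [← sinh_two_mul]; ring_nf
    rw [sub_half, h2] at h1
    refine le_of_mul_le_mul_left ?_ (sinh_pos_iff.2 (half_pos h))
    linarith

theorem cosh_add_le {a ε : ℝ} (hε : 0 ≤ ε) : cosh (a + ε) ≤ exp ε * cosh a := by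
  rw [cosh_eq, cosh_eq, neg_add, exp_add, exp_add]
  have h1 : exp (-ε) ≤ exp ε := exp_le_exp.2 (by linarith)
  nlinarith [mul_le_mul_of_nonneg_left h1 (exp_pos (-a)).le]

theorem cosh_le_of_le {a b : ℝ} (ha : 0 ≤ a) (hab : a ≤ b) : cosh a ≤ cosh b := by
  rw [cosh_le_cosh, abs_of_nonneg ha, abs_of_nonneg (ha.trans hab)]
  exact hab

/-- Almost midpoints are close to midpoints, uniformly in the distance of the end points. -/
theorem IsCATNegOne.cosh_dist_le_exp (hX : IsCATNegOne X) {x y m z : X} {ε : ℝ}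
    (hxm : dist x m ≤ dist x y / 2) (hym : dist y m ≤ dist x y / 2) (hε : 0 ≤ ε)
    (hxz : dist x z ≤ dist x y / 2 + ε) (hyz : dist y z ≤ dist x y / 2 + ε) :
    cosh (dist z m) ≤ exp ε := by
  obtain ⟨c, hc⟩ := hX.exists_segment x y
  -- The midpoint inequality has `cosh (dist x y / 2)` on the left and at most `exp δ` times it on
  -- the right; cancelling it removes the dependence on `dist x y`. The case `δ = 0` identifies `m`
  -- with the midpoint of the segment.
  have key : ∀ {w : X} {δ : ℝ}, 0 ≤ δ → dist x w ≤ dist x y / 2 + δ → dist y w ≤ dist x y / 2 + δ →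
      cosh (dist w (c (dist x y / 2))) ≤ exp δ := by
    intro w δ hδ h1 h2
    have h3 := hX.cosh_dist_midpoint_le hc w
    have h4 := cosh_add_le (a := dist x y / 2) hδ
    have h5 := cosh_le_of_le dist_nonneg h1
    have h6 := cosh_le_of_le dist_nonneg h2
    rw [dist_comm w x, dist_comm w y] at h3
    refine le_of_mul_le_mul_left ?_ (cosh_pos (dist x y / 2))
    linarith
  have hm : m = c (dist x y / 2) := by
    have h := key le_rfl (by rwa [add_zero]) (by rwa [add_zero])
    rw [exp_zero] at h
    have h0 := cosh_le_cosh.1 (h.trans_eq cosh_zero.symm)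
    rw [abs_zero, abs_of_nonneg dist_nonneg] at h0
    exact dist_le_zero.1 h0
  rw [hm]
  exact key hε hxz hyz

theorem IsCATNegOne.exists_midpoint (hX : IsCATNegOne X) (x y : X) :
    ∃ m, dist x m = dist x y / 2 ∧ dist y m = dist x y / 2 := by
  obtain ⟨c, hc⟩ := hX.exists_segment x y
  have h0 : 0 ≤ dist x y := dist_nonneg
  have hmem : dist x y / 2 ∈ Set.Icc 0 (dist x y) := ⟨by linarith, by linarith⟩
  refine ⟨c (dist x y / 2), ?_, ?_⟩
  · have h := hc.isometric 0 ⟨le_rfl, h0⟩ _ hmem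
    rwa [hc.source, zero_sub, abs_neg, abs_of_nonneg (by linarith)] at h
  · have h := hc.isometric _ ⟨h0, le_rfl⟩ _ hmem
    rwa [hc.target, sub_half, abs_of_nonneg (by linarith)] at h

/-- The distance from `(x, y)` to `(r, r)` is the larger of `dist x r` and `dist y r`, hence at
least `dist x y / 2` by the triangle inequality, with equality at a midpoint. -/
theorem IsCATNegOne.isNearestPoint_iff (hX : IsCATNegOne X) (p : X × X) (q : Set.diagonal X) :
    IsNearestPoint p q ↔
      dist p.1 q.1.1 ≤ dist p.1 p.2 / 2 ∧ dist p.2 q.1.1 ≤ dist p.1 p.2 / 2 := by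
  have hd : ∀ r : Set.diagonal X, dist p r.1 = max (dist p.1 r.1.1) (dist p.2 r.1.1) := by
    rintro ⟨⟨a, b⟩, hab⟩
    obtain rfl : a = b := hab
    rfl
  constructor
  · intro h
    obtain ⟨m, hm1, hm2⟩ := hX.exists_midpoint p.1 p.2
    have h1 := h ⟨(m, m), rfl⟩
    rw [hd, hd, hm1, hm2, max_self] at h1
    exact max_le_iff.1 h1
  · intro h r
    rw [hd, hd]
    refine (max_le h.1 h.2).trans ?_
    have h1 := dist_triangle_right p.1 p.2 r.1.1
    have h2 := le_max_left (dist p.1 r.1.1) (dist p.2 r.1.1)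
    have h3 := le_max_right (dist p.1 r.1.1) (dist p.2 r.1.1)
    linarith

theorem IsCATNegOne.existsUnique_isNearestPoint (hX : IsCATNegOne X) (p : X × X) :
    ∃! q : Set.diagonal X, IsNearestPoint p q := by
  obtain ⟨m, hm1, hm2⟩ := hX.exists_midpoint p.1 p.2
  refine ⟨⟨(m, m), rfl⟩, (hX.isNearestPoint_iff p _).2 ⟨hm1.le, hm2.le⟩, ?_⟩
  rintro ⟨⟨a, b⟩, hab⟩ h
  obtain rfl : a = b := hab
  have h1 := (hX.isNearestPoint_iff p _).1 h
  have h2 := hX.cosh_dist_le_exp hm1.le hm2.le le_rfl (by simpa using h1.1) (by simpa using h1.2)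
  rw [exp_zero] at h2
  have h0 := cosh_le_cosh.1 (h2.trans_eq cosh_zero.symm)
  rw [abs_zero, abs_of_nonneg dist_nonneg] at h0
  obtain rfl := dist_le_zero.1 h0
  rfl

/-- Almost midpoints converge to midpoints. -/
theorem IsCATNegOne.tendsto_dist_midpoint (hX : IsCATNegOne X) {ι : Type*} {l : Filter ι}
    {x y m z : ι → X} {δ : ι → ℝ} (hxm : ∀ i, dist (x i) (m i) ≤ dist (x i) (y i) / 2)
    (hym : ∀ i, dist (y i) (m i) ≤ dist (x i) (y i) / 2)
    (hxz : ∀ i, dist (x i) (z i) ≤ dist (x i) (y i) / 2 + δ i)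
    (hyz : ∀ i, dist (y i) (z i) ≤ dist (x i) (y i) / 2 + δ i) (hδ : Tendsto δ l (𝓝 0)) :
    Tendsto (fun i => dist (z i) (m i)) l (𝓝 0) := by
  have h : Tendsto (fun i => exp |δ i|) l (𝓝 1) := by
    have := (continuous_exp.tendsto _).comp hδ.abs
    simpa [Function.comp_def] using this
  refine tendsto_zero_of_cosh_le (Eventually.of_forall fun i => ?_) h
  exact hX.cosh_dist_le_exp (hxm i) (hym i) (abs_nonneg _)
    ((hxz i).trans (add_le_add_right (le_abs_self _) _))
    ((hyz i).trans (add_le_add_right (le_abs_self _) _))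

/-! ### Rays and their Busemann functions -/

theorem Ray.dist_eq (r : Ray X) (s t : ℝ≥0) : dist (r.1 s) (r.1 t) = |(s : ℝ) - t| := by
  rw [r.2.dist_eq, NNReal.dist_eq]

theorem Ray.dist_zero (r : Ray X) (t : ℝ≥0) : dist (r.1 0) (r.1 t) = t := by
  rw [r.dist_eq, NNReal.coe_zero, zero_sub, abs_neg, NNReal.abs_eq]

theorem Ray.isSegment (r : Ray X) (t : ℝ≥0) :
    IsSegment (fun s => r.1 s.toNNReal) (r.1 0) (r.1 t) where
  source := by simp
  target := by simp [r.dist_zero]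
  isometric := by
    intro a ha b hb
    rw [r.dist_eq, Real.coe_toNNReal _ ha.1, Real.coe_toNNReal _ hb.1]

/-- The Busemann function `z ↦ lim dist z (r t) - t` of the ray `r`. -/
noncomputable def Ray.busemann (r : Ray X) (z : X) : ℝ :=
  limUnder atTop fun t : ℝ≥0 => dist z (r.1 t) - (t : ℝ)

theorem Ray.tendsto_busemann (r : Ray X) (z : X) :
    Tendsto (fun t : ℝ≥0 => dist z (r.1 t) - (t : ℝ)) atTop (𝓝 (r.busemann z)) := by
  refine tendsto_nhds_limUnder ⟨_, tendsto_atTop_ciInf ?_ ⟨-dist z (r.1 0), ?_⟩⟩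
  · intro s t hst
    have h1 := dist_triangle z (r.1 s) (r.1 t)
    have h2 : (s : ℝ) ≤ t := hst
    rw [r.dist_eq, abs_sub_comm, abs_of_nonneg (sub_nonneg.2 h2)] at h1
    simp only
    linarith
  · rintro _ ⟨t, rfl⟩
    have h1 := dist_triangle_left (r.1 0) (r.1 t) z
    rw [r.dist_zero] at h1
    simp only
    linarith

theorem Ray.busemann_le_add (r : Ray X) (z w : X) : r.busemann z ≤ dist z w + r.busemann w := by
  refine le_of_tendsto_of_tendsto' (r.tendsto_busemann z)
    ((r.tendsto_busemann w).const_add (dist z w)) fun t => ?_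
  have := dist_triangle z w (r.1 t)
  linarith

theorem Ray.busemann_apply (r : Ray X) (s : ℝ≥0) : r.busemann (r.1 s) = -s := by
  refine tendsto_nhds_unique (r.tendsto_busemann _) (tendsto_const_nhds.congr' ?_)
  filter_upwards [eventually_ge_atTop s] with t ht
  have h2 : (s : ℝ) ≤ t := ht
  rw [r.dist_eq, abs_sub_comm, abs_of_nonneg (sub_nonneg.2 h2)]
  ring

theorem tendsto_dist_sub (r : Ray X) (z w : X) :
    Tendsto (fun t : ℝ≥0 => dist z (r.1 t) - dist w (r.1 t)) atTop
      (𝓝 (r.busemann z - r.busemann w)) :=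
  ((r.tendsto_busemann z).sub (r.tendsto_busemann w)).congr fun t => by ring

theorem Ray.tendsto_dist_atTop (r : Ray X) (z : X) :
    Tendsto (fun t : ℝ≥0 => dist z (r.1 t)) atTop atTop :=
  ((r.tendsto_busemann z).add_atTop (NNReal.tendsto_coe_atTop.2 tendsto_id)).congr fun t => by simp

/-- Limit of Stewart's inequality on the initial segments of `r`, whose Busemann function vanishes
at `r 0`. -/
theorem IsCATNegOne.cosh_dist_ray_le (hX : IsCATNegOne X) (r : Ray X) (z : X) (s : ℝ≥0) :
    cosh (dist z (r.1 s)) ≤ exp (-s) * cosh (dist z (r.1 0)) + sinh s * exp (r.busemann z) := by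
  have h := hX.cosh_dist_le_of_tendsto (l := atTop) (z := z) (s := s) (x := r.1 s) r.isSegment
    (r.tendsto_dist_atTop _) (tendsto_dist_sub r z (r.1 0)) s.2
    (tendsto_const_nhds.congr fun _ => by rw [Real.toNNReal_coe])
  rwa [r.busemann_apply, NNReal.coe_zero, neg_zero, sub_zero] at h

/-- Turns the limit form of Stewart's inequality into an estimate of `d - s` by `β`, with an error
of order `exp (-2 * s)`. -/
theorem exp_sub_le_of_cosh_le {d s a β : ℝ}
    (h : cosh d ≤ exp (-s) * a + sinh s * exp β) :
    exp (d - s) ≤ 2 * exp (-s) ^ 2 * a + exp β := by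
  have h1 : exp d ≤ 2 * cosh d := by
    rw [cosh_eq]; linarith [exp_pos (-d)]
  have h2 : 2 * sinh s ≤ exp s := by
    rw [sinh_eq]; linarith [exp_pos (-s)]
  have h3 : exp s * exp (-s) = 1 := by rw [← exp_add, add_neg_cancel, exp_zero]
  have h4 := mul_le_mul_of_nonneg_right h2 (exp_pos β).le
  have h5 : exp d ≤ 2 * exp (-s) * a + exp s * exp β := by linarith
  have h6 := mul_le_mul_of_nonneg_right h5 (exp_pos (-s)).le
  rw [sub_eq_add_neg, exp_add]
  refine h6.trans_eq ?_
  linear_combination exp β * h3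

/-- Uniform convergence to the Busemann function of a ray. -/
theorem IsCATNegOne.exp_dist_sub_le (hX : IsCATNegOne X) (r : Ray X) (z : X) (s : ℝ≥0) :
    exp (dist z (r.1 s) - s) ≤
      2 * exp (-s) ^ 2 * cosh (dist z (r.1 0)) + exp (r.busemann z) :=
  exp_sub_le_of_cosh_le (hX.cosh_dist_ray_le r z s)

theorem Ray.busemann_le (r : Ray X) (z : X) (s : ℝ≥0) :
    r.busemann z ≤ dist z (r.1 s) - s := by
  have := r.busemann_le_add z (r.1 s)
  rw [r.busemann_apply] at this
  linarith

/-- Asymptotic rays with the same origin coincide. -/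
theorem IsCATNegOne.ray_eq (hX : IsCATNegOne X) {c c' : Ray X} (h0 : c.1 0 = c'.1 0)
    (h : (raySetoid X).r c c') : c = c' := by
  obtain ⟨C, hC⟩ := h
  refine Subtype.ext (funext fun s => ?_)
  by_contra hne
  have hX1 : 0 < cosh (dist (c'.1 s) (c.1 s)) - 1 :=
    sub_pos.2 (one_lt_cosh.2 (dist_pos.2 (Ne.symm hne)).ne')
  -- Stewart is applied to `c' s` against `c` on `[0, t]`, then to `c t` against `c'` on `[0, t]`;
  -- eliminating the diagonal `dist (c' s) (c t)` leaves this bound, whose right side does not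
  -- depend on `t`.
  have key : ∀ t : ℝ≥0, s ≤ t → sinh t ^ 2 * (cosh (dist (c'.1 s) (c.1 s)) - 1) ≤
      sinh s ^ 2 * (cosh C - 1) := by
    intro t hst
    have hst' : (s : ℝ) ≤ t := hst
    have h1 := hX.stewart (c.isSegment t) (c'.1 s) (s := s) ⟨s.2, by rwa [c.dist_zero]⟩
    have h2 := hX.stewart (c'.isSegment t) (c.1 t) (s := s) ⟨s.2, by rwa [c'.dist_zero]⟩
    have h3 : cosh (dist (c.1 t) (c'.1 t)) ≤ cosh C := cosh_le_of_le dist_nonneg (hC t)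
    rw [c.dist_zero, Real.toNNReal_coe, h0, dist_comm _ (c'.1 0), c'.dist_zero] at h1
    rw [c'.dist_zero, Real.toNNReal_coe, ← h0, dist_comm _ (c.1 0), c.dist_zero,
      dist_comm (c.1 t) (c'.1 s)] at h2
    have hs0 : 0 ≤ sinh (s : ℝ) := sinh_nonneg_iff.2 s.2
    have ht0 : 0 ≤ sinh (t : ℝ) := sinh_nonneg_iff.2 t.2
    have h4 := mul_le_mul_of_nonneg_left h1 ht0
    have h5 := mul_le_mul_of_nonneg_left h2 hs0
    have h6 := mul_le_mul_of_nonneg_left (mul_le_mul_of_nonneg_left h3 hs0) hs0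
    rw [sinh_sub] at h4 h5
    have e1 := cosh_sq (s : ℝ)
    have e2 := cosh_sq (t : ℝ)
    have e3 : sinh (t : ℝ) * ((sinh t * cosh s - cosh t * sinh s) * cosh s) +
        sinh s * ((sinh t * cosh s - cosh t * sinh s) * cosh t) = sinh t ^ 2 - sinh s ^ 2 := by
      linear_combination sinh (t : ℝ) ^ 2 * e1 - sinh (s : ℝ) ^ 2 * e2
    linarith
  obtain ⟨M, hM⟩ : ∃ M, M = sinh s ^ 2 * (cosh C - 1) / (cosh (dist (c'.1 s) (c.1 s)) - 1) :=
    ⟨_, rfl⟩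
  have key' : ∀ t : ℝ≥0, s ≤ t → sinh (t : ℝ) ^ 2 ≤ M := fun t ht => by
    rw [hM, le_div_iff₀ hX1]
    exact key t ht
  -- Here `t ≥ 1` and `t > M`, so `sinh t ^ 2 ≥ t ^ 2 > M`.
  have h1 := key' (s + 1 + M.toNNReal) (by rw [add_assoc]; exact le_self_add)
  have h2 := self_le_sinh_iff.2 (s + 1 + M.toNNReal).2
  have h3 : ((s + 1 + M.toNNReal : ℝ≥0) : ℝ) = s + 1 + M.toNNReal := by push_cast; rfl
  have h4 := Real.le_coe_toNNReal M
  have h5 : (0 : ℝ) ≤ s := s.2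
  have h6 : (0 : ℝ) ≤ M.toNNReal := M.toNNReal.2
  change ((s + 1 + M.toNNReal : ℝ≥0) : ℝ) ≤ sinh ((s + 1 + M.toNNReal : ℝ≥0) : ℝ) at h2
  rw [h3] at h1 h2
  nlinarith

/-- The ray from `o` asymptotic to `r`. -/
theorem IsCATNegOne.exists_asymptotic_ray [ProperSpace X] (hX : IsCATNegOne X) (r : Ray X)
    (o : X) : ∃ c : Ray X, c.1 0 = o ∧
      (∀ (s : ℝ≥0) (z : X), cosh (dist z (c.1 s)) ≤
        exp (-s) * cosh (dist z o) + sinh s * exp (r.busemann z - r.busemann o)) ∧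
      ∀ s : ℝ≥0, r.busemann (c.1 s) = r.busemann o - s := by
  choose σ hσ using fun t : ℝ≥0 => hX.exists_segment o (r.1 t)
  -- An ultrafilter makes the segments from `o` to `r t` converge at all `s` at once, by compactness
  -- of closed balls, with no diagonal subsequence.
  let U : Ultrafilter ℝ≥0 := Ultrafilter.of atTop
  have hU : (U : Filter ℝ≥0) ≤ atTop := Ultrafilter.of_le _
  have hL : Tendsto (fun t => dist o (r.1 t)) U atTop := (r.tendsto_dist_atTop o).mono_left hU
  have hlim : ∀ s : ℝ≥0, ∃ x, Tendsto (fun t => σ t s) U (𝓝 x) := by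
    intro s
    have hball : ((U.map fun t => σ t s : Ultrafilter X) : Filter X) ≤
        𝓟 (Metric.closedBall o (s : ℝ)) := by
      rw [le_principal_iff]
      change ∀ᶠ t in (U : Filter ℝ≥0), σ t s ∈ Metric.closedBall o (s : ℝ)
      filter_upwards [hL.eventually_ge_atTop (s : ℝ)] with t ht
      have h := (hσ t).isometric s ⟨s.2, ht⟩ 0 ⟨le_rfl, dist_nonneg⟩
      rw [(hσ t).source, sub_zero, NNReal.abs_eq] at h
      exact h.le
    obtain ⟨x, -, hx⟩ := (isCompact_closedBall o (s : ℝ)).ultrafilter_le_nhds _ hball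
    exact ⟨x, hx⟩
  choose c hc using hlim
  have hiso : Isometry c := by
    refine Isometry.of_dist_eq fun s s' => ?_
    refine tendsto_nhds_unique ((hc s).dist (hc s')) (tendsto_const_nhds.congr' ?_)
    filter_upwards [hL.eventually_ge_atTop (s : ℝ), hL.eventually_ge_atTop (s' : ℝ)] with t h1 h2
    rw [(hσ t).isometric s ⟨s.2, h1⟩ s' ⟨s'.2, h2⟩, NNReal.dist_eq]
  refine ⟨⟨c, hiso⟩, ?_, fun s z => ?_, fun s => ?_⟩
  · refine tendsto_nhds_unique (hc 0) (tendsto_const_nhds.congr fun t => ?_)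
    rw [NNReal.coe_zero, (hσ t).source]
  · exact hX.cosh_dist_le_of_tendsto hσ hL ((tendsto_dist_sub r z o).mono_left hU) s.2 (hc s)
  · refine tendsto_nhds_unique ((r.tendsto_busemann (c s)).mono_left hU) ?_
    -- `c s` may be replaced by `σ t s`, which is exactly `s` closer to `r t` than `o` is.
    have h1 : Tendsto (fun t => dist (c s) (r.1 t) - dist (σ t s) (r.1 t)) U (𝓝 0) := by
      have h := tendsto_iff_dist_tendsto_zero.1 (hc s)
      refine squeeze_zero_norm (fun t => ?_) h
      rw [dist_comm (σ t s) (c s)]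
      exact abs_dist_sub_le _ _ _
    have h2 := h1.add (((r.tendsto_busemann o).mono_left hU).sub_const (s : ℝ))
    rw [zero_add] at h2
    refine h2.congr' ?_
    filter_upwards [hL.eventually_ge_atTop (s : ℝ)] with t ht
    have h := (hσ t).isometric s ⟨s.2, ht⟩ _ ⟨dist_nonneg, le_rfl⟩
    rw [(hσ t).target, abs_sub_comm, abs_of_nonneg (sub_nonneg.2 ht)] at h
    rw [h]
    ring

theorem tendsto_exp_neg_sq_mul (a : ℝ) :
    Tendsto (fun s : ℝ≥0 => 2 * exp (-(s : ℝ)) ^ 2 * a) atTop (𝓝 0) := by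
  have h := tendsto_exp_neg_atTop_nhds_zero.comp (NNReal.tendsto_coe_atTop.2 tendsto_id)
  simpa [Function.comp_def] using ((h.pow 2).const_mul 2).mul_const a

/-- The Busemann function of the class of a ray `r`, based at any point, is the Busemann function
of `r` up to normalization. -/
theorem IsCATNegOne.busemann_endpoint [ProperSpace X] (hX : IsCATNegOne X) (r : Ray X) (o z : X) :
    MaxCompactification.busemann r.endpoint o z = r.busemann z - r.busemann o := by
  obtain ⟨c, hc0, hcosh, hcb⟩ := hX.exists_asymptotic_ray r o
  have hcr : (raySetoid X).r c r := by
    -- With `z = r s` the two terms of the bound on `cosh (dist z (c s))` are at most these two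
    -- constants, because the Busemann function is `-s` at `r s`.
    refine ⟨cosh (dist (r.1 0) o) + exp (-r.busemann o), fun s => ?_⟩
    have h1 := hcosh s (r.1 s)
    rw [r.busemann_apply] at h1
    have h2 : cosh (dist (r.1 s) o) ≤ exp s * cosh (dist (r.1 0) o) := by
      refine (cosh_le_of_le dist_nonneg ?_).trans (cosh_add_le s.2)
      have := dist_triangle_left (r.1 s) o (r.1 0)
      rw [r.dist_zero] at this
      linarith
    have h3 : sinh (s : ℝ) ≤ exp s := by
      have := cosh_add_sinh (s : ℝ)
      linarith [cosh_pos (s : ℝ)]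
    have h4 : exp (-(s : ℝ)) * exp s = 1 := by rw [← exp_add, neg_add_cancel, exp_zero]
    have h5 := mul_le_mul_of_nonneg_left h2 (exp_pos (-(s : ℝ))).le
    have h6 := mul_le_mul_of_nonneg_right h3 (exp_pos (-(s : ℝ) - r.busemann o)).le
    have h7 : exp (s : ℝ) * exp (-(s : ℝ) - r.busemann o) = exp (-r.busemann o) := by
      rw [← exp_add]; ring_nf
    rw [← mul_assoc, h4, one_mul] at h5
    have h8 := self_le_sinh_iff.2 (dist_nonneg (x := c.1 s) (y := r.1 s))
    have h9 := sinh_lt_cosh (dist (c.1 s) (r.1 s))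
    rw [dist_comm (r.1 s) (c.1 s)] at h1
    linarith
  have h : ∃ c : Ray X, c.1 0 = o ∧ Ray.endpoint c = r.endpoint := ⟨c, hc0, Quotient.sound hcr⟩
  have hch : h.choose = c := by
    refine hX.ray_eq (h.choose_spec.1.trans hc0.symm) (Quotient.exact (s := raySetoid X) ?_)
    exact h.choose_spec.2.trans (Quotient.sound hcr).symm
  rw [MaxCompactification.busemann, dif_pos h, hch]
  -- The upper bound is the `cosh` estimate as `s → ∞`. The lower bound holds because `r.busemann`
  -- is 1-Lipschitz and falls at unit rate along `c`.
  refine le_antisymm ?_ ?_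
  · rw [← exp_le_exp]
    have h1 := (tendsto_exp_neg_sq_mul (cosh (dist z o))).add_const
      (exp (r.busemann z - r.busemann o))
    rw [zero_add] at h1
    exact le_of_tendsto_of_tendsto' ((continuous_exp.tendsto _).comp (c.tendsto_busemann z)) h1
      fun s => exp_sub_le_of_cosh_le (hcosh s z)
  · refine ge_of_tendsto' (c.tendsto_busemann z) fun s => ?_
    have := r.busemann_le_add z (c.1 s)
    rw [hcb] at this
    linarith

/-- Before the limit, `exp (dist z (r t) - t)` is continuous in the ray, and it exceeds its limit by
at most `2 * exp (-t) ^ 2 * cosh (dist z (r 0))`. Dividing by this `cosh` makes the convergence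
uniform over all rays. -/
theorem IsCATNegOne.continuous_busemann (hX : IsCATNegOne X) {α : Type*} [TopologicalSpace α]
    {r : α → Ray X} (hr : ∀ t, Continuous fun a => (r a).1 t) (z : X) :
    Continuous fun a => (r a).busemann z := by
  have h1 : TendstoUniformly
      (fun (t : ℝ≥0) a => exp (dist z ((r a).1 t) - t) / cosh (dist z ((r a).1 0)))
      (fun a => exp ((r a).busemann z) / cosh (dist z ((r a).1 0))) atTop := by
    rw [Metric.tendstoUniformly_iff]
    intro ε hε
    filter_upwards [(tendsto_exp_neg_sq_mul 1).eventually_lt_const hε] with t ht a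
    have hc := cosh_pos (dist z ((r a).1 0))
    have h2 := hX.exp_dist_sub_le (r a) z t
    have h3 := exp_le_exp.2 ((r a).busemann_le z t)
    rw [dist_comm, dist_eq_norm, ← sub_div, norm_of_nonneg (div_nonneg (sub_nonneg.2 h3) hc.le)]
    refine lt_of_le_of_lt ?_ ht
    rw [div_le_iff₀ hc]
    linarith
  have h4 := h1.continuous (Frequently.of_forall fun t =>
    ((continuous_exp.comp ((continuous_const.dist (hr t)).sub continuous_const))).div
      (continuous_cosh.comp (continuous_const.dist (hr 0))) fun a => (cosh_pos _).ne')
  have h5 : Continuous fun a => exp ((r a).busemann z) :=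
    (h4.mul (continuous_cosh.comp ((continuous_const (y := z)).dist (hr 0)))).congr
      fun a => div_mul_cancel₀ _ (cosh_pos _).ne'
  exact (h5.log fun a => (exp_pos _).ne').congr fun a => log_exp _

theorem IsCATNegOne.continuous_busemann_posEnd [ProperSpace X] (hX : IsCATNegOne X) (o z : X) :
    Continuous fun g : Geodesic X => busemann g.posEnd o z := by
  have h : ∀ z, Continuous fun g : Geodesic X => g.posRay.busemann z :=
    hX.continuous_busemann fun t => (continuous_eval_const (t : ℝ)).comp continuous_subtype_val
  exact ((h z).sub (h o)).congr fun g => (hX.busemann_endpoint _ _ _).symm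

theorem IsCATNegOne.continuous_busemann_negEnd [ProperSpace X] (hX : IsCATNegOne X) (o z : X) :
    Continuous fun g : Geodesic X => busemann g.negEnd o z := by
  have h : ∀ z, Continuous fun g : Geodesic X => g.negRay.busemann z :=
    hX.continuous_busemann fun t => (continuous_eval_const (-(t : ℝ))).comp continuous_subtype_val
  exact ((h z).sub (h o)).congr fun g => (hX.busemann_endpoint _ _ _).symm

theorem Geodesic.busemann_posRay (g : Geodesic X) (t : ℝ) : g.posRay.busemann (g.1 t) = -t := by
  refine tendsto_nhds_unique (g.posRay.tendsto_busemann _) (tendsto_const_nhds.congr' ?_)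
  filter_upwards [eventually_ge_atTop t.toNNReal] with s hs
  have h : t ≤ s := Real.toNNReal_le_iff_le_coe.1 hs
  change -t = dist (g.1 t) (g.1 s) - s
  rw [g.2.dist_eq, Real.dist_eq, abs_sub_comm, abs_of_nonneg (sub_nonneg.2 h)]
  ring

theorem Geodesic.busemann_negRay (g : Geodesic X) (t : ℝ) : g.negRay.busemann (g.1 t) = t := by
  refine tendsto_nhds_unique (g.negRay.tendsto_busemann _) (tendsto_const_nhds.congr' ?_)
  filter_upwards [eventually_ge_atTop (-t).toNNReal] with s hs
  have h : -t ≤ s := Real.toNNReal_le_iff_le_coe.1 hs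
  change t = dist (g.1 t) (g.1 (-s)) - s
  rw [g.2.dist_eq, Real.dist_eq, abs_of_nonneg (by linarith)]
  ring

/-! ### Convergence and the topology of `X × X ∪ G` -/

theorem TendstoBoundary.tendsto {o : X} {x : ℕ → X} {ξ : IdealBoundary X}
    (h : TendstoBoundary o x ξ) (z : X) :
    Tendsto (fun n => dist (x n) z - dist (x n) o) atTop (𝓝 (busemann ξ o z)) :=
  (h {z} isCompact_singleton).tendsto_at rfl

/-- Normalized distance functions are 1-Lipschitz, hence equicontinuous, so pointwise convergence is
already uniform on compact sets. -/
theorem tendstoBoundary_of_tendsto {o : X} {x : ℕ → X} {ξ : IdealBoundary X}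
    (h : ∀ z, Tendsto (fun n => dist (x n) z - dist (x n) o) atTop (𝓝 (busemann ξ o z))) :
    TendstoBoundary o x ξ := by
  intro K hK
  have heq : UniformEquicontinuous fun n z => dist (x n) z - dist (x n) o :=
    LipschitzWith.uniformEquicontinuous _ 1 fun n => LipschitzWith.of_dist_le_mul fun z w => by
      rw [Real.dist_eq, NNReal.coe_one, one_mul, sub_sub_sub_cancel_right, dist_comm (x n) z,
        dist_comm (x n) w]
      exact abs_dist_sub_le _ _ _
  have h1 := (EquicontinuousOn.tendsto_uniformOnFun_iff_pi (𝔖 := {K : Set X | IsCompact K})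
    (fun K hK => hK) (Set.eq_univ_of_forall fun z => ⟨{z}, isCompact_singleton, rfl⟩)
    (fun K _ => heq.equicontinuous.equicontinuousOn K) atTop (busemann ξ o)).2
    (tendsto_pi_nhds.2 h)
  exact UniformOnFun.tendsto_iff_tendstoUniformlyOn.1 h1 K hK

theorem continuous_extended_iff (o : X) {Y : Type*} [TopologicalSpace Y] {F : Extended X → Y}
    (h1 : Continuous fun p => F (Extended.pt p)) (h2 : Continuous fun g => F (Extended.geod g))
    (h3 : ∀ (u : ℕ → X × X) (g : Geodesic X), TendstoGeodesic o u g →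
      Tendsto (fun n => F (Extended.pt (u n))) atTop (𝓝 (F (Extended.geod g)))) :
    @Continuous _ _ (extendedTopology o) _ F := by
  let _ := extendedTopology o
  refine continuous_def.2 fun V hV => ⟨hV.preimage h1, hV.preimage h2, fun u g hg hu => ?_⟩
  exact (h3 u g hu).eventually (hV.mem_nhds hg)

theorem isOpenEmbedding_pt (o : X) :
    @IsOpenEmbedding _ _ _ (extendedTopology o) (Extended.pt : X × X → Extended X) := by
  let _ := extendedTopology o
  refine IsOpenEmbedding.of_continuous_injective_isOpenMap
    (continuous_def.2 fun V hV => hV.1) (fun p q h => by injection h) fun V hV => ?_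
  refine ⟨?_, ?_, ?_⟩
  · rwa [Set.preimage_image_eq _ fun p q h => by injection h]
  · have : (Extended.geod ⁻¹' (Extended.pt '' V) : Set (Geodesic X)) = ∅ := by
      ext g; simp
    rw [this]
    exact isOpen_empty
  · rintro u g ⟨p, -, hp⟩
    cases hp

theorem isClosedEmbedding_geod (o : X) :
    @IsClosedEmbedding _ _ _ (extendedTopology o) (Extended.geod : Geodesic X → Extended X) := by
  let _ := extendedTopology o
  refine IsClosedEmbedding.of_continuous_injective_isClosedMap
    (continuous_def.2 fun V hV => hV.2.1) (fun p q h => by injection h) fun C hC => ?_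
  refine ⟨⟨?_, ?_, ?_⟩⟩
  · have : (Extended.pt ⁻¹' (Extended.geod '' C)ᶜ : Set (X × X)) = Set.univ := by
      ext g; simp
    rw [this]
    exact isOpen_univ
  · rw [Set.preimage_compl, Set.preimage_image_eq _ fun p q h => by injection h]
    exact hC.isOpen_compl
  · intro u g _ _
    refine Eventually.of_forall fun n => ?_
    rintro ⟨g', -, hg'⟩
    cases hg'

/-- Convergence of sequences of `X × X` to points of `G` in `X × X ∪ G`: the Busemann functions
define continuous functions on `X × X ∪ G`. -/
theorem IsCATNegOne.tendsto_pt_iff [ProperSpace X] (hX : IsCATNegOne X) (o : X) (u : ℕ → X × X)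
    (g : Geodesic X) :
    Tendsto (fun n => Extended.pt (u n)) atTop (@nhds _ (extendedTopology o) (Extended.geod g)) ↔
      TendstoGeodesic o u g := by
  let _ := extendedTopology o
  constructor
  · intro h
    refine ⟨tendstoBoundary_of_tendsto fun z => ?_, tendstoBoundary_of_tendsto fun z => ?_, ?_⟩
    · have hF := continuous_extended_iff o
        (F := fun e => match e with
          | Extended.pt p => dist p.1 z - dist p.1 o
          | Extended.geod g => busemann g.posEnd o z)
        (by fun_prop) (hX.continuous_busemann_posEnd o z) fun u g hu => hu.1.tendsto z
      exact (hF.tendsto _).comp h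
    · have hF := continuous_extended_iff o
        (F := fun e => match e with
          | Extended.pt p => dist p.2 z - dist p.2 o
          | Extended.geod g => busemann g.negEnd o z)
        (by fun_prop) (hX.continuous_busemann_negEnd o z) fun u g hu => hu.2.1.tendsto z
      exact (hF.tendsto _).comp h
    -- Although `g 0` moves with `g`, both Busemann functions of `g` vanish there, so the expression
    -- is a difference of their values at the fixed point `o`.
    · have hG : Continuous fun g : Geodesic X =>
          busemann g.negEnd o (g.1 0) - busemann g.posEnd o (g.1 0) := by
        have hp : ∀ z, Continuous fun g : Geodesic X => g.posRay.busemann z :=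
          hX.continuous_busemann fun t =>
            (continuous_eval_const (t : ℝ)).comp continuous_subtype_val
        have hn : ∀ z, Continuous fun g : Geodesic X => g.negRay.busemann z :=
          hX.continuous_busemann fun t =>
            (continuous_eval_const (-(t : ℝ))).comp continuous_subtype_val
        refine ((hp o).sub (hn o)).congr fun g => ?_
        rw [Geodesic.negEnd, Geodesic.posEnd, hX.busemann_endpoint, hX.busemann_endpoint,
          g.busemann_posRay, g.busemann_negRay, Pi.sub_apply]
        ring
      have hF := continuous_extended_iff o
        (F := fun e => match e with
          | Extended.pt p => dist p.1 o - dist p.2 o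
          | Extended.geod g => busemann g.negEnd o (g.1 0) - busemann g.posEnd o (g.1 0))
        (by fun_prop) hG fun u g hu => hu.2.2
      exact (hF.tendsto _).comp h
  · intro h
    refine tendsto_nhds.2 fun V hV hg => ?_
    exact hV.2.2 u g hg h

/-! ### Convergence of midpoints and continuity of the retraction -/

theorem Geodesic.dist_eq (g : Geodesic X) (s t : ℝ) : dist (g.1 s) (g.1 t) = |s - t| := by
  rw [g.2.dist_eq, Real.dist_eq]

section

variable [ProperSpace X] {o : X} {x : ℕ → X} {g : Geodesic X}

theorem IsCATNegOne.tendsto_dist_sub_posEnd (hX : IsCATNegOne X)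
    (h : TendstoBoundary o x g.posEnd) (t : ℝ) :
    Tendsto (fun n => dist (x n) (g.1 t) - dist (x n) (g.1 0)) atTop (𝓝 (-t)) := by
  have h1 := (h.tendsto (g.1 t)).sub (h.tendsto (g.1 0))
  rw [Geodesic.posEnd, hX.busemann_endpoint, hX.busemann_endpoint, g.busemann_posRay,
    g.busemann_posRay] at h1
  convert h1 using 2 <;> ring

theorem IsCATNegOne.tendsto_dist_sub_negEnd (hX : IsCATNegOne X)
    (h : TendstoBoundary o x g.negEnd) (t : ℝ) :
    Tendsto (fun n => dist (x n) (g.1 t) - dist (x n) (g.1 0)) atTop (𝓝 t) := by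
  have h1 := (h.tendsto (g.1 t)).sub (h.tendsto (g.1 0))
  rw [Geodesic.negEnd, hX.busemann_endpoint, hX.busemann_endpoint, g.busemann_negRay,
    g.busemann_negRay] at h1
  convert h1 using 2 <;> ring

/-- Eventually `g 0` is farther from `x n` than `g (b + 1)` is by more than `b`. -/
theorem IsCATNegOne.tendsto_dist_atTop_of_posEnd (hX : IsCATNegOne X)
    (h : TendstoBoundary o x g.posEnd) :
    Tendsto (fun n => dist (x n) (g.1 0)) atTop atTop := by
  refine tendsto_atTop.2 fun b => ?_
  filter_upwards [(hX.tendsto_dist_sub_posEnd h (b + 1)).eventually_lt_const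
    (show -(b + 1) < -b by linarith)] with n hn
  linarith [dist_nonneg (x := x n) (y := g.1 (b + 1))]

theorem IsCATNegOne.tendsto_dist_atTop_of_negEnd (hX : IsCATNegOne X)
    (h : TendstoBoundary o x g.negEnd) :
    Tendsto (fun n => dist (x n) (g.1 0)) atTop atTop := by
  refine tendsto_atTop.2 fun b => ?_
  filter_upwards [(hX.tendsto_dist_sub_negEnd h (-(b + 1))).eventually_lt_const
    (show -(b + 1) < -b by linarith)] with n hn
  linarith [dist_nonneg (x := x n) (y := g.1 (-(b + 1)))]

/-- If `x n` and `y n` converge to the two ends of a geodesic through `p`, then the Gromov product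
of `x n` and `y n` with respect to `p` tends to `0`. -/
theorem IsCATNegOne.tendsto_gromov_product (hX : IsCATNegOne X)
    {y : ℕ → X} (hx : TendstoBoundary o x g.posEnd)
    (hy : TendstoBoundary o y g.negEnd) :
    Tendsto (fun n => dist (x n) (g.1 0) + dist (y n) (g.1 0) - dist (x n) (y n)) atTop (𝓝 0) := by
  obtain ⟨p, hp⟩ : ∃ p, p = g.1 0 := ⟨_, rfl⟩
  choose σ hσ using fun n => hX.exists_segment p (y n)
  have hD := hX.tendsto_dist_atTop_of_posEnd hx
  have hE := hX.tendsto_dist_atTop_of_negEnd hy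
  have hx1 := hX.tendsto_dist_sub_posEnd hx (-1)
  have hy1 := hX.tendsto_dist_sub_negEnd hy (-1)
  have hz : dist (g.1 (-1)) p = 1 := by rw [hp, g.dist_eq]; norm_num
  rw [← hp] at *
  simp only [dist_comm (y _) _] at hE hy1
  -- The point at distance 1 on the segment from `p` to `y n` tends to `g (-1)`: the Stewart bound
  -- for `cosh` has limit `exp (-1) * cosh 1 + sinh 1 * exp (-1) = 1`.
  have hw : Tendsto (fun n => dist (g.1 (-1)) (σ n 1)) atTop (𝓝 0) := by
    refine tendsto_zero_of_cosh_le ?_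
      ((tendsto_stewart_bound hE hy1 1 (cosh (dist (g.1 (-1)) p))).trans_eq ?_)
    · filter_upwards [hE.eventually_ge_atTop 1] with n hn
      exact hX.cosh_dist_le_div (hσ n) _ ⟨zero_le_one, hn⟩ (by linarith)
    · congr 1
      rw [hz, mul_comm, ← add_mul, cosh_add_sinh, ← exp_add, add_neg_cancel, exp_zero]
  have hF : Tendsto (fun n => dist (x n) (σ n 1) - dist (x n) p) atTop (𝓝 1) := by
    have h1 : Tendsto (fun n => dist (x n) (σ n 1) - dist (x n) (g.1 (-1))) atTop (𝓝 0) := by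
      refine squeeze_zero_norm (fun n => ?_) hw
      rw [dist_comm (x n), dist_comm (x n), dist_comm (g.1 (-1)) (σ n 1)]
      exact abs_dist_sub_le _ _ _
    have h2 := h1.add hx1
    rw [neg_neg, zero_add] at h2
    exact h2.congr fun n => by ring
  have hself : ∀ {f : ℕ → ℝ}, Tendsto (fun n => f n - f n) atTop (𝓝 0) := fun {f} =>
    tendsto_const_nhds.congr fun n => by ring
  -- Stewart for `x n` and the point `σ n 1` is read backwards, as a lower bound for `cosh (dist (x
  -- n) (y n))`. Scaled by `exp (-dist (x n) p - dist p (y n))` and doubled, this bound tends to 1;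
  -- `a4` also discards the decaying half of `cosh`. The triangle inequality gives the upper bound
  -- 1.
  have a1 := (tendsto_sinh_mul_exp_neg hE hself).mul (tendsto_cosh_mul_exp_neg hD hF)
  have a2 := (tendsto_sinh_mul_exp_neg (E := fun n => dist p (y n) - 1) (β := -1) hE
    (tendsto_const_nhds.congr fun n => by ring)).mul (tendsto_cosh_mul_exp_neg hD hself)
  have a3 := ((a1.sub a2).div_const (sinh 1)).const_mul 2
  have hs1 : 0 < sinh (1 : ℝ) := sinh_pos_iff.2 one_pos
  have a4 := a3.sub ((tendsto_exp_neg_atTop_nhds_zero.comp hD).mul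
    (tendsto_exp_neg_atTop_nhds_zero.comp hE))
  have e : 2 * ((exp 0 / 2 * (exp 1 / 2) - exp (-1) / 2 * (exp 0 / 2)) / sinh 1) - 0 * 0 = 1 := by
    have h : sinh 1 = (exp 1 - exp (-1)) / 2 := sinh_eq 1
    rw [exp_zero, mul_zero, sub_zero, ← mul_div_assoc, div_eq_one_iff_eq hs1.ne', h]
    ring
  rw [e] at a4
  have a5 : Tendsto (fun n => exp (-(dist (x n) p + dist (y n) p - dist (x n) (y n)))) atTop
      (𝓝 1) := by
    refine tendsto_of_tendsto_of_tendsto_of_le_of_le' a4 tendsto_const_nhds ?_ ?_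
    · filter_upwards [hE.eventually_ge_atTop 1] with n hn
      have h1 := hX.stewart (hσ n) (x n) (s := 1) ⟨zero_le_one, hn⟩
      simp only [Function.comp_apply]
      rw [sub_le_iff_le_add, ← mul_div_assoc, div_le_iff₀ hs1]
      have hpos : 0 < exp (-dist p (y n)) * exp (-dist (x n) p) :=
        mul_pos (exp_pos _) (exp_pos _)
      have h2 : 2 * cosh (dist (x n) (y n)) * (exp (-dist p (y n)) * exp (-dist (x n) p)) ≤
          exp (-(dist (x n) p + dist (y n) p - dist (x n) (y n))) +
            exp (-dist (x n) p) * exp (-dist p (y n)) := by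
        have h3 : exp (-dist (x n) (y n)) ≤ 1 := exp_le_one_iff.2 (neg_nonpos.2 dist_nonneg)
        have h4 : exp (-(dist (x n) p + dist (y n) p - dist (x n) (y n))) =
            exp (dist (x n) (y n)) * (exp (-dist p (y n)) * exp (-dist (x n) p)) := by
          rw [← exp_add, ← exp_add, dist_comm (y n) p]
          ring_nf
        rw [h4, cosh_eq]
        have := mul_le_mul_of_nonneg_right h3 hpos.le
        linarith
      have h5 := mul_le_mul_of_nonneg_right h1 hpos.le
      have h6 := mul_le_mul_of_nonneg_right h2 hs1.le
      linarith
    · refine Eventually.of_forall fun n => exp_le_one_iff.2 ?_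
      have := dist_triangle_right (x n) (y n) p
      linarith
  have a6 := (a5.log one_ne_zero).neg
  rw [log_one, neg_zero] at a6
  exact a6.congr fun n => by rw [log_exp, neg_neg]

/-- The midpoints of a sequence that converges to a geodesic `g` converge to `g 0`. -/
theorem IsCATNegOne.tendsto_midpoint (hX : IsCATNegOne X)
    {u : ℕ → X × X} (hu : TendstoGeodesic o u g) {m : ℕ → X}
    (h1 : ∀ n, dist (u n).1 (m n) ≤ dist (u n).1 (u n).2 / 2)
    (h2 : ∀ n, dist (u n).2 (m n) ≤ dist (u n).1 (u n).2 / 2) :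
    Tendsto m atTop (𝓝 (g.1 0)) := by
  have hG := hX.tendsto_gromov_product hu.1 hu.2.1
  -- The third condition of `(∗)` is made for this: its limit cancels the Busemann values at `g 0`
  -- that arise on replacing `o` by `g 0`.
  have hS : Tendsto (fun n => dist (u n).1 (g.1 0) - dist (u n).2 (g.1 0)) atTop (𝓝 0) := by
    have h := ((hu.1.tendsto (g.1 0)).sub (hu.2.1.tendsto (g.1 0))).add hu.2.2
    convert h using 2 <;> ring
  -- Two numbers with sum `dist x y + G` and difference `S` are at most `dist x y / 2 + (|S| + G) /
  -- 2`.
  have hδ := (hS.abs.add hG).div_const 2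
  rw [abs_zero, add_zero, zero_div] at hδ
  have h := hX.tendsto_dist_midpoint (z := fun _ => g.1 0) h1 h2 (fun n => ?_) (fun n => ?_) hδ
  · rw [tendsto_iff_dist_tendsto_zero]
    exact h.congr fun n => dist_comm _ _
  · have := le_abs_self (dist (u n).1 (g.1 0) - dist (u n).2 (g.1 0))
    linarith
  · have := neg_abs_le (dist (u n).1 (g.1 0) - dist (u n).2 (g.1 0))
    linarith

end

/-- The midpoint of `q` is an almost midpoint of every pair near `q`, with an error that vanishes at
`q`. -/
theorem IsCATNegOne.continuous_midpoint (hX : IsCATNegOne X) {m : X × X → X}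
    (h1 : ∀ p, dist p.1 (m p) ≤ dist p.1 p.2 / 2) (h2 : ∀ p, dist p.2 (m p) ≤ dist p.1 p.2 / 2) :
    Continuous m := by
  refine continuous_iff_continuousAt.2 fun q => ?_
  have hδ : Tendsto (fun p : X × X => dist p.1 q.1 + dist p.2 q.2 +
      |dist q.1 q.2 - dist p.1 p.2| / 2) (𝓝 q) (𝓝 0) := by
    have hc : Continuous fun p : X × X => dist p.1 q.1 + dist p.2 q.2 +
      |dist q.1 q.2 - dist p.1 p.2| / 2 := by fun_prop
    simpa using hc.tendsto q
  have h := hX.tendsto_dist_midpoint (z := fun _ => m q) h1 h2 (fun p => ?_) (fun p => ?_) hδ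
  · rw [ContinuousAt, tendsto_iff_dist_tendsto_zero]
    exact h.congr fun n => dist_comm _ _
  · have a1 := dist_triangle p.1 q.1 (m q)
    have a2 := le_abs_self (dist q.1 q.2 - dist p.1 p.2)
    linarith [h1 q, dist_nonneg (x := p.2) (y := q.2)]
  · have a1 := dist_triangle p.2 q.2 (m q)
    have a2 := le_abs_self (dist q.1 q.2 - dist p.1 p.2)
    linarith [h2 q, dist_nonneg (x := p.1) (y := q.1)]

theorem IsCATNegOne.continuous_extendRetraction [ProperSpace X] (hX : IsCATNegOne X) (o : X)
    {ρ : X × X → Set.diagonal X} (hρ : ∀ p, IsNearestPoint p (ρ p)) :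
    @Continuous _ _ (extendedTopology o) _ (extendRetraction ρ) := by
  let _ := extendedTopology o
  have h1 := fun p => ((hX.isNearestPoint_iff p _).1 (hρ p)).1
  have h2 := fun p => ((hX.isNearestPoint_iff p _).1 (hρ p)).2
  have h : Continuous fun e => (extendRetraction ρ e).1.1 :=
    continuous_extended_iff o (hX.continuous_midpoint h1 h2)
      ((continuous_eval_const (0 : ℝ)).comp continuous_subtype_val) fun u g hu =>
      hX.tendsto_midpoint hu (fun n => h1 _) fun n => h2 _
  refine continuous_induced_rng.2 ((h.prodMk h).congr fun e => ?_)
  exact Prod.ext rfl (extendRetraction ρ e).2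

end MaxCompactification

theorem mainTheorem7 {X : Type*} [MetricSpace X] [ProperSpace X] [NoncompactSpace X]
    (hX : MaxCompactification.IsCATNegOne X) (o : X) :
    -- the topology of `X × X ∪ G` induces the given ones on `X × X` and `G`,
    -- and has the prescribed convergence of sequences of `X × X` to points of `G`
    (@Topology.IsOpenEmbedding _ _ _ (MaxCompactification.extendedTopology o)
        (MaxCompactification.Extended.pt : X × X → MaxCompactification.Extended X) ∧
      @Topology.IsClosedEmbedding _ _ _ (MaxCompactification.extendedTopology o)
        (MaxCompactification.Extended.geod :
          MaxCompactification.Geodesic X → MaxCompactification.Extended X) ∧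
      ∀ (u : ℕ → X × X) (g : MaxCompactification.Geodesic X),
        Filter.Tendsto (fun n => MaxCompactification.Extended.pt (u n)) Filter.atTop
            (@nhds _ (MaxCompactification.extendedTopology o)
              (MaxCompactification.Extended.geod g)) ↔
          MaxCompactification.TendstoGeodesic o u g) ∧
    -- every point of `X × X` has exactly one nearest point in the diagonal
    (∀ p : X × X, ∃! q : Set.diagonal X, MaxCompactification.IsNearestPoint p q) ∧
    -- the extension of the nearest point retraction is continuous
    ∀ ρ : X × X → Set.diagonal X, (∀ p, MaxCompactification.IsNearestPoint p (ρ p)) →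
      @Continuous _ _ (MaxCompactification.extendedTopology o) _
        (MaxCompactification.extendRetraction ρ) :=
  ⟨⟨MaxCompactification.isOpenEmbedding_pt o, MaxCompactification.isClosedEmbedding_geod o,
    hX.tendsto_pt_iff o⟩, hX.existsUnique_isNearestPoint,
    fun _ hρ => hX.continuous_extendRetraction o hρ⟩
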